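/- Proposition (lattice path delta-matroids are closed under duals and minors). Set systems. A set system $S=(E,\mathcal F)$ is a finite set $E$ with a collection $\mathcal F$ of subsets of $E$, its feasible sets. Two set systems are isomorphic if some bijection between their ground sets carries feasible sets to feasible sets in both directions. The dual of $S$ is $S^*=(E,\{E\setminus F : F\in\mathcal F\})$. An element $e\in E$ is a loop if no feasible set contains it, and a coloop if every feasible set contains it. If $e$ is not a loop, $S/e=(E\setminus e,\{F\setminus e : e\in F\in\mathcal F\})$; if $e$ is not a coloop, $S\backslash e=(E\setminus e,\{F\in\mathcal F : F\subseteq E\setminus e\})$; if $e$ is a loop or a coloop, the one of $S/e$, $S\backslash e$ not yet defined is set equal to the other. A minor of $S$ is any set system obtained from $S$ by a (possibly empty) sequence of deletions $\backslash e$ and contractions $/e$. Full Higgs lifts. Let $Q$ and $L$ be matroids on the same finite set $E$ with $Q$ a quotient of $L$. For $0\le i\le r(L)-r(Q)$ the bases of the $i$-th Higgs lift of $Q$ toward $L$ are the sets of size $r(Q)+i$ that contain a basis of $Q$ and are contained in a basis of $L$. The full Higgs lift delta-matroid of $(Q,L)$ is the delta-matroid on $E$ whose feasible sets are the bases of all these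 Higgs lifts. Regions. Let $u,c,d\ge 0$ and $v$ be integers with $v-c\ge d$, and put $s_P=(0,0)$, $s_Q=(-d,d)$, $t_P=(u+c,v-c)$, $t_Q=(u,v)$. Lattice paths have unit steps, each north or east. Let $P$ be a lattice path from $s_P$ to $t_P$ and $Q$ a lattice path from $s_Q$ to $t_Q$ such that $P$ never goes above $Q$; with the segments $s_Ps_Q$ and $t_Pt_Q$ they bound a region $\mathcal R$. Label each north step by the sum of the coordinates of its higher endpoint, so that the labels lie in $E=\{1,2,\ldots,u+v\}$. Let $M(\mathcal R_{\min})$ be the matroid on $E$ whose bases are the sets of labels on the north steps of the lattice paths from $s_Q$ to $t_P$ that remain in $\mathcal R$, and let $M(\mathcal R_{\max})$ be the matroid on $E$ whose bases are obtained in the same way from the lattice paths from $s_P$ to $t_Q$. (The former is a quotient of the latter.) A lattice path delta-matroid is a set system that is isomorphic, for some such region $\mathcal R$, to the full Higgs lift delta-matroid of the pair $(M(\mathcal R_{\min}),M(\mathcal R_{\max}))$. Claim. If $S$ is a lattice path delta-matroid, then its dual $S^*$ is a lattice path delta-matroid, and every minor of $S$ is a lattice path delta-matroid. -/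

import Mathlib

/-- A set system: a finite ground set together with a collection of subsets of it. -/
structure SetSystem (α : Type*) where
  ground : Set α
  ground_finite : ground.Finite
  feasible : Set (Set α)
  subset_ground : ∀ F ∈ feasible, F ⊆ ground

namespace SetSystem

variable {α β : Type*}

/-- Two set systems are isomorphic if some bijection between their ground sets carries
feasible sets to feasible sets, in both directions. -/
def Isomorphic (S : SetSystem α) (T : SetSystem β) : Prop :=
  ∃ φ : S.ground ≃ T.ground, ∀ A : Set S.ground,
    Subtype.val '' A ∈ S.feasible ↔ Subtype.val '' (φ '' A) ∈ T.feasible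

/-- The element `e` of the ground set is a loop: no feasible set contains it. -/
def IsLoop (S : SetSystem α) (e : α) : Prop := e ∈ S.ground ∧ ∀ F ∈ S.feasible, e ∉ F

/-- The element `e` of the ground set is a coloop: every feasible set contains it. -/
def IsColoop (S : SetSystem α) (e : α) : Prop := e ∈ S.ground ∧ ∀ F ∈ S.feasible, e ∈ F

/-- The set system `(E - e, {F - e : e ∈ F ∈ 𝓕})`. -/
def link (S : SetSystem α) (e : α) : SetSystem α where
  ground := S.ground \ {e}
  ground_finite := S.ground_finite.sdiff
  feasible := {F | ∃ F' ∈ S.feasible, e ∈ F' ∧ F = F' \ {e}}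
  subset_ground := by
    rintro F ⟨F', hF', -, rfl⟩
    exact Set.sdiff_subset_sdiff_left (S.subset_ground F' hF')

/-- The set system `(E - e, {F ⊆ E - e : F ∈ 𝓕})`. -/
def avoid (S : SetSystem α) (e : α) : SetSystem α where
  ground := S.ground \ {e}
  ground_finite := S.ground_finite.sdiff
  feasible := {F | F ∈ S.feasible ∧ F ⊆ S.ground \ {e}}
  subset_ground := fun _ hF => hF.2

open Classical in
/-- Contraction `S / e`; for a loop it agrees with deletion. -/
noncomputable def contract (S : SetSystem α) (e : α) : SetSystem α :=
  if S.IsLoop e then S.avoid e else S.link e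

open Classical in
/-- Deletion `S \ e`; for a coloop it agrees with contraction. -/
noncomputable def delete (S : SetSystem α) (e : α) : SetSystem α :=
  if S.IsColoop e then S.link e else S.avoid e

/-- `S.IsMinor T`: the set system `T` is obtained from `S` by a (possibly empty) sequence of
deletions and contractions of elements. -/
inductive IsMinor (S : SetSystem α) : SetSystem α → Prop
  | refl : IsMinor S S
  | delete {T : SetSystem α} {e : α} (hT : IsMinor S T) (he : e ∈ T.ground) :
      IsMinor S (T.delete e)
  | contract {T : SetSystem α} {e : α} (hT : IsMinor S T) (he : e ∈ T.ground) :
      IsMinor S (T.contract e)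

/-- The twist `S * A = (E, {F ∆ A : F ∈ 𝓕})` for `A ⊆ E`. -/
def twist (S : SetSystem α) (A : Set α) (hA : A ⊆ S.ground) : SetSystem α where
  ground := S.ground
  ground_finite := S.ground_finite
  feasible := {F | ∃ F' ∈ S.feasible, F = symmDiff F' A}
  subset_ground := by
    rintro F ⟨F', hF', rfl⟩ x hx
    rcases hx with hx | hx
    · exact S.subset_ground F' hF' hx.1
    · exact hA hx.1

/-- The dual `S* = S * E`. -/
def dual (S : SetSystem α) : SetSystem α := S.twist S.ground subset_rfl

end SetSystem

/-- The bases of the `i`-th Higgs lift of `Q` toward `L` (for a quotient `Q` of `L` and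
`0 ≤ i ≤ r(L) - r(Q)`): the sets of size `r(Q) + i` that contain a basis of `Q` and are contained
in a basis of `L`. -/
def higgsLiftBases {α : Type*} (Q L : Matroid α) (i : ℕ) : Set (Set α) :=
  {F | F.encard = Q.eRank + i ∧ ∃ A B, Q.IsBase A ∧ L.IsBase B ∧ A ⊆ F ∧ F ⊆ B}

/-- The full Higgs lift delta-matroid of the pair `(Q, L)` on a common finite ground set: its
feasible sets are the bases of all Higgs lifts of `Q` toward `L`. -/
def fullHiggsLift {α : Type*} (Q L : Matroid α) [L.Finite] : SetSystem α where
  ground := L.E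
  ground_finite := L.ground_finite
  feasible := {F | ∃ i : ℕ, Q.eRank + i ≤ L.eRank ∧ F ∈ higgsLiftBases Q L i}
  subset_ground := by
    rintro F ⟨i, -, -, A, B, -, hB, -, hFB⟩
    exact hFB.trans hB.subset_ground

/-- `p 0, p 1, …, p n` are the successive points of a lattice path with `n` unit steps, each
going east or north. (The values of `p` beyond `n` play no role.) -/
def IsLatticePath (n : ℕ) (p : ℕ → ℤ × ℤ) : Prop :=
  ∀ i < n, p (i + 1) = p i + (1, 0) ∨ p (i + 1) = p i + (0, 1)

/-- The set of labels on the north steps of a path with `n` steps, where a north step is labelled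
by the sum of the coordinates of its higher endpoint. -/
def northLabels (n : ℕ) (p : ℕ → ℤ × ℤ) : Set ℤ :=
  {k | ∃ i < n, p (i + 1) = p i + (0, 1) ∧ k = (p (i + 1)).1 + (p (i + 1)).2}

/-- The data of a region bounded by two lattice paths: `P` from `s_P = (0, 0)` to
`t_P = (u + c, v - c)` and `Q` from `s_Q = (-d, d)` to `t_Q = (u, v)`, where `d ≤ v - c`, with `P`
never going above `Q`. The `i`-th points of the two paths lie on the common line `x + y = i`, so
the latter is a comparison of heights. -/
structure LatticePathRegion where
  (u v c d : ℕ)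
  d_le : (d : ℤ) ≤ v - c
  (P Q : ℕ → ℤ × ℤ)
  path_P : IsLatticePath (u + v) P
  path_Q : IsLatticePath (u + v) Q
  P_start : P 0 = (0, 0)
  P_end : P (u + v) = ((u : ℤ) + c, (v : ℤ) - c)
  Q_start : Q 0 = (-(d : ℤ), (d : ℤ))
  Q_end : Q (u + v) = ((u : ℤ), (v : ℤ))
  P_le_Q : ∀ i ≤ u + v, (P i).2 ≤ (Q i).2

namespace LatticePathRegion

/-- `p` is a lattice path from `s` to `t` that remains in the region. -/
def IsPathFromTo (R : LatticePathRegion) (s t : ℤ × ℤ) (p : ℕ → ℤ × ℤ) : Prop :=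
  IsLatticePath (R.u + R.v) p ∧ p 0 = s ∧ p (R.u + R.v) = t ∧
    ∀ i ≤ R.u + R.v, (R.P i).2 ≤ (p i).2 ∧ (p i).2 ≤ (R.Q i).2

/-- `B` is the set of north-step labels of a path from `s` to `t` in the region. -/
def IsPathBase (R : LatticePathRegion) (s t : ℤ × ℤ) (B : Set ℤ) : Prop :=
  ∃ p, R.IsPathFromTo s t p ∧ B = northLabels (R.u + R.v) p

/-- The set `{1, 2, …, u + v}` of labels. -/
def labels (R : LatticePathRegion) : Set ℤ := Set.Icc 1 ((R.u : ℤ) + R.v)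

/-- Paths starting on the line `x + y = 0` are determined by their heights. -/
theorem isPathBase_iff (R : LatticePathRegion) {s t : ℤ × ℤ} (hs : s.1 + s.2 = 0)
    (ht : t.1 + t.2 = R.u + R.v) (B : Set ℤ) :
    R.IsPathBase s t B ↔ ∃ h : ℕ → ℤ,
      (∀ i < R.u + R.v, h (i + 1) = h i ∨ h (i + 1) = h i + 1) ∧
      h 0 = s.2 ∧ h (R.u + R.v) = t.2 ∧
      (∀ i ≤ R.u + R.v, (R.P i).2 ≤ h i ∧ h i ≤ (R.Q i).2) ∧
      B = {k | ∃ i < R.u + R.v, h (i + 1) = h i + 1 ∧ k = (i : ℤ) + 1} := by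
  constructor
  · rintro ⟨p, ⟨hp, h0, hn, hb⟩, rfl⟩
    have hsum : ∀ i ≤ R.u + R.v, (p i).1 + (p i).2 = i := by
      intro i
      induction i with
      | zero => intro _; rw [h0, hs]; rfl
      | succ i ih =>
        intro hi
        have := ih (by omega)
        rcases hp i (by omega) with h | h <;> rw [h] <;> simp <;> omega
    refine ⟨fun i => (p i).2, ?_, by simp [h0], by simp [hn], hb, ?_⟩
    · intro i hi
      rcases hp i hi with h | h <;> simp [h]
    · ext k
      constructor
      · rintro ⟨i, hi, h, rfl⟩
        have := hsum (i + 1) (by omega)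
        exact ⟨i, hi, by simp [h], by rw [this]; push_cast; rfl⟩
      · rintro ⟨i, hi, h, rfl⟩
        have := hsum (i + 1) (by omega)
        refine ⟨i, hi, ?_, by rw [this]; push_cast; rfl⟩
        rcases hp i hi with h' | h'
        · simp [h'] at h
        · exact h'
  · rintro ⟨h, hp, h0, hn, hb, rfl⟩
    refine ⟨fun i => ((i : ℤ) - h i, h i), ⟨?_, ?_, ?_, hb⟩, ?_⟩
    · intro i hi
      rcases hp i hi with h' | h'
      · left; ext <;> simp [h']; ring
      · right; ext <;> simp [h']
    · ext <;> simp [h0]; omega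
    · ext <;> simp [hn]; omega
    · ext k
      constructor
      · rintro ⟨i, hi, h', rfl⟩
        exact ⟨i, hi, by ext <;> simp [h'], by simp⟩
      · rintro ⟨i, hi, h', rfl⟩
        exact ⟨i, hi, by simpa using congrArg Prod.snd h', by simp⟩

theorem isPathBase_subset (R : LatticePathRegion) {s t : ℤ × ℤ} (hs : s.1 + s.2 = 0)
    (ht : t.1 + t.2 = R.u + R.v) (B : Set ℤ) (hB : R.IsPathBase s t B) : B ⊆ R.labels := by
  obtain ⟨h, -, -, -, -, rfl⟩ := (R.isPathBase_iff hs ht B).1 hB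
  rintro k ⟨i, hi, -, rfl⟩
  exact ⟨by omega, by omega⟩

theorem labels_finite (R : LatticePathRegion) : R.labels.Finite := Set.finite_Icc _ _

/-- The basis exchange property for the paths between two fixed points of the region. -/
theorem isPathBase_exchange (R : LatticePathRegion) {s t : ℤ × ℤ} (hs : s.1 + s.2 = 0)
    (ht : t.1 + t.2 = R.u + R.v) : Matroid.ExchangeProperty (R.IsPathBase s t) := by
  intro X Y hX hY x hx
  obtain ⟨f, hf, f0, fn, fb, rfl⟩ := (R.isPathBase_iff hs ht X).1 hX
  obtain ⟨g, hg, g0, gn, gb, rfl⟩ := (R.isPathBase_iff hs ht Y).1 hY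
  obtain ⟨⟨a, ha, hfa, rfl⟩, hxY⟩ := hx
  have hga : g (a + 1) = g a := by
    rcases hg a ha with h | h
    · exact h
    · exact absurd ⟨a, ha, h, rfl⟩ hxY
  by_cases hD : g (a + 1) < f (a + 1)
  · -- lower the path to the right of the removed step
    have hex : ∃ j, a + 1 < j ∧ j ≤ R.u + R.v ∧ f j ≤ g j := by
      refine ⟨R.u + R.v, ?_, le_rfl, by rw [fn, gn]⟩
      rcases Nat.lt_or_ge (a + 1) (R.u + R.v) with h | h
      · exact h
      · have : a + 1 = R.u + R.v := by omega
        rw [this, fn, gn] at hD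
        omega
    classical
    obtain ⟨hj1, hj2, hj3⟩ := Nat.find_spec hex
    have hmin : ∀ i, a + 1 ≤ i → i < Nat.find hex → g i < f i := by
      intro i hi1 hi2
      rcases Nat.eq_or_lt_of_le hi1 with h | h
      · rw [← h]; exact hD
      · by_contra hc
        exact Nat.find_min hex hi2 ⟨h, by omega, by omega⟩
    generalize Nat.find hex = j at *
    obtain ⟨b, rfl⟩ : ∃ b, j = b + 1 := ⟨j - 1, by omega⟩
    have hb := hmin b (by omega) (by omega)
    have hfb : f (b + 1) = f b := by
      rcases hf b (by omega) with h | h <;> rcases hg b (by omega) with h' | h' <;> omega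
    have hgb : g (b + 1) = g b + 1 := by
      rcases hg b (by omega) with h' | h' <;> omega
    refine ⟨(b : ℤ) + 1, ⟨⟨b, by omega, hgb, rfl⟩, ?_⟩, ?_⟩
    · rintro ⟨i, -, h, h'⟩
      obtain rfl : i = b := by omega
      omega
    · rw [R.isPathBase_iff hs ht]
      refine ⟨fun i => if a + 1 ≤ i ∧ i ≤ b then f i - 1 else f i, ?_, ?_, ?_, ?_, ?_⟩
      · intro i hi
        have := hf i hi
        beta_reduce
        rcases eq_or_ne i a with rfl | h1
        · simp [show i + 1 ≤ b by omega]; omega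
        · rcases eq_or_ne i b with rfl | h2
          · simp [show a + 1 ≤ i by omega]; omega
          · by_cases h3 : a + 1 ≤ i ∧ i ≤ b
            · rw [if_pos (by omega), if_pos h3]; omega
            · rw [if_neg (by omega), if_neg h3]; omega
      · simp [f0]
      · simp only []; rw [if_neg (by omega)]; exact fn
      · intro i hi
        have h1 := fb i hi
        have h2 := gb i hi
        simp only []
        split_ifs with h3
        · have := hmin i h3.1 (by omega); omega
        · exact h1
      · ext k
        constructor
        · rintro (rfl | ⟨⟨i, hi, h, rfl⟩, hne⟩)
          · refine ⟨b, by omega, ?_, rfl⟩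
            simp only []
            rw [if_neg (by omega), if_pos (by omega)]; omega
          · have h1 : i ≠ a := by rintro rfl; exact hne rfl
            have h2 : i ≠ b := by rintro rfl; omega
            refine ⟨i, hi, ?_, rfl⟩
            simp only []
            by_cases h3 : a + 1 ≤ i ∧ i ≤ b
            · rw [if_pos (by omega), if_pos h3]; omega
            · rw [if_neg (by omega), if_neg h3]; omega
        · rintro ⟨i, hi, h, rfl⟩
          rcases eq_or_ne i b with rfl | h2
          · left; rfl
          · right
            simp only [] at h
            have h1 : i ≠ a := by
              rintro rfl
              rw [if_pos (by omega), if_neg (by omega)] at h; omega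
            refine ⟨⟨i, hi, ?_, rfl⟩, by simpa using h1⟩
            by_cases h3 : a + 1 ≤ i ∧ i ≤ b
            · rw [if_pos (by omega), if_pos h3] at h; omega
            · rw [if_neg (by omega), if_neg h3] at h; omega
  · -- raise the path to the left of the removed step
    have hD' : f a < g a := by omega
    classical
    have hex : ∃ m, m ≤ a ∧ g (a - m) ≤ f (a - m) :=
      ⟨a, le_rfl, by simp [f0, g0]⟩
    obtain ⟨hm1, hm2⟩ := Nat.find_spec hex
    have hmin : ∀ i, i ≤ a → a - Nat.find hex < i → f i < g i := by
      intro i hi1 hi2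
      by_contra hc
      exact Nat.find_min hex (m := a - i) (by omega)
        ⟨by omega, by rw [show a - (a - i) = i by omega]; omega⟩
    generalize Nat.find hex = m at *
    obtain ⟨b, hb⟩ : ∃ b, b = a - m := ⟨_, rfl⟩
    rw [← hb] at hm2 hmin
    have hba : b < a := by
      rcases Nat.lt_or_ge b a with h | h
      · exact h
      · obtain rfl : b = a := by omega
        omega
    have hb1 := hmin (b + 1) (by omega) (by omega)
    have hfb : f (b + 1) = f b := by
      rcases hf b (by omega) with h | h <;> rcases hg b (by omega) with h' | h' <;> omega
    have hgb : g (b + 1) = g b + 1 := by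
      rcases hg b (by omega) with h' | h' <;> omega
    refine ⟨(b : ℤ) + 1, ⟨⟨b, by omega, hgb, rfl⟩, ?_⟩, ?_⟩
    · rintro ⟨i, -, h, h'⟩
      obtain rfl : i = b := by omega
      omega
    · rw [R.isPathBase_iff hs ht]
      refine ⟨fun i => if b + 1 ≤ i ∧ i ≤ a then f i + 1 else f i, ?_, ?_, ?_, ?_, ?_⟩
      · intro i hi
        have := hf i hi
        beta_reduce
        rcases eq_or_ne i a with rfl | h1
        · simp [show b + 1 ≤ i by omega]; omega
        · rcases eq_or_ne i b with rfl | h2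
          · simp [show i + 1 ≤ a by omega]; omega
          · by_cases h3 : b + 1 ≤ i ∧ i ≤ a
            · rw [if_pos (by omega), if_pos h3]; omega
            · rw [if_neg (by omega), if_neg h3]; omega
      · simp [f0]
      · simp only []; rw [if_neg (by omega)]; exact fn
      · intro i hi
        have h1 := fb i hi
        have h2 := gb i hi
        simp only []
        split_ifs with h3
        · have := hmin i h3.2 (by omega); omega
        · exact h1
      · ext k
        constructor
        · rintro (rfl | ⟨⟨i, hi, h, rfl⟩, hne⟩)
          · refine ⟨b, by omega, ?_, rfl⟩
            simp only []
            rw [if_pos (by omega), if_neg (by omega)]; omega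
          · have h1 : i ≠ a := by rintro rfl; exact hne rfl
            have h2 : i ≠ b := by rintro rfl; omega
            refine ⟨i, hi, ?_, rfl⟩
            simp only []
            by_cases h3 : b + 1 ≤ i ∧ i ≤ a
            · rw [if_pos (by omega), if_pos h3]; omega
            · rw [if_neg (by omega), if_neg h3]; omega
        · rintro ⟨i, hi, h, rfl⟩
          rcases eq_or_ne i b with rfl | h2
          · left; rfl
          · right
            simp only [] at h
            have h1 : i ≠ a := by
              rintro rfl
              rw [if_neg (by omega), if_pos (by omega)] at h; omega
            refine ⟨⟨i, hi, ?_, rfl⟩, by simpa using h1⟩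
            by_cases h3 : b + 1 ≤ i ∧ i ≤ a
            · rw [if_pos (by omega), if_pos h3] at h; omega
            · rw [if_neg (by omega), if_neg h3] at h; omega

/-- The starting point `s_P`. -/
def sP (_R : LatticePathRegion) : ℤ × ℤ := (0, 0)
/-- The starting point `s_Q`. -/
def sQ (R : LatticePathRegion) : ℤ × ℤ := (-(R.d : ℤ), (R.d : ℤ))
/-- The end point `t_P`. -/
def tP (R : LatticePathRegion) : ℤ × ℤ := ((R.u : ℤ) + R.c, (R.v : ℤ) - R.c)
/-- The end point `t_Q`. -/
def tQ (R : LatticePathRegion) : ℤ × ℤ := ((R.u : ℤ), (R.v : ℤ))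

theorem height_step {n : ℕ} {p : ℕ → ℤ × ℤ} (hp : IsLatticePath n p) (i : ℕ) (hi : i < n) :
    (p (i + 1)).2 = (p i).2 ∨ (p (i + 1)).2 = (p i).2 + 1 := by
  rcases hp i hi with h | h <;> simp [h]

theorem height_mono {n : ℕ} {p : ℕ → ℤ × ℤ} (hp : IsLatticePath n p) (i j : ℕ) (hij : i ≤ j)
    (hj : j ≤ n) : (p i).2 ≤ (p j).2 ∧ (p j).2 ≤ (p i).2 + ((j : ℤ) - i) := by
  induction j, hij using Nat.le_induction with
  | base => omega
  | succ j hij ih =>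
    have := ih (by omega)
    have := height_step hp j (by omega)
    push_cast
    omega

theorem exists_minBase (R : LatticePathRegion) : ∃ B, R.IsPathBase R.sQ R.tP B := by
  simp only [R.isPathBase_iff (s := R.sQ) (t := R.tP) (by simp [sQ]) (by simp [tP])]
  refine ⟨_, fun i => max (R.P i).2 R.d, ?_, ?_, ?_, ?_, rfl⟩
  · intro i hi
    have := height_step R.path_P i hi
    simp only []; omega
  · simp [R.P_start, sQ]
  · have := R.d_le
    simp only [R.P_end, tP]; omega
  · intro i hi
    have h1 := R.P_le_Q i hi
    have h2 := (height_mono R.path_Q 0 i (by omega) hi).1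
    rw [R.Q_start] at h2
    simp only [] at h2 ⊢
    omega

theorem exists_maxBase (R : LatticePathRegion) : ∃ B, R.IsPathBase R.sP R.tQ B := by
  simp only [R.isPathBase_iff (s := R.sP) (t := R.tQ) (by simp [sP]) (by simp [tQ])]
  refine ⟨_, fun i => max (R.P i).2 ((i : ℤ) - R.u), ?_, ?_, ?_, ?_, rfl⟩
  · intro i hi
    have := height_step R.path_P i hi
    simp only []; push_cast; omega
  · simp [R.P_start, sP]
  · simp only [R.P_end, tQ]; push_cast; omega
  · intro i hi
    have h1 := R.P_le_Q i hi
    have h2 := (height_mono R.path_Q i (R.u + R.v) hi le_rfl).2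
    rw [R.Q_end] at h2
    push_cast at h2
    simp only [] at h2 ⊢
    omega

/-- The lattice path matroid `M(R_min)`: its bases come from the paths from `s_Q` to `t_P`. -/
def minMatroid (R : LatticePathRegion) : Matroid ℤ :=
  Matroid.ofIsBaseOfFinite R.labels_finite (R.IsPathBase R.sQ R.tP) R.exists_minBase
    (R.isPathBase_exchange (by simp [sQ]) (by simp [tP]))
    (R.isPathBase_subset (by simp [sQ]) (by simp [tP]))

/-- The lattice path matroid `M(R_max)`: its bases come from the paths from `s_P` to `t_Q`. -/
def maxMatroid (R : LatticePathRegion) : Matroid ℤ :=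
  Matroid.ofIsBaseOfFinite R.labels_finite (R.IsPathBase R.sP R.tQ) R.exists_maxBase
    (R.isPathBase_exchange (by simp [sP]) (by simp [tQ]))
    (R.isPathBase_subset (by simp [sP]) (by simp [tQ]))

instance (R : LatticePathRegion) : R.maxMatroid.Finite := ⟨R.labels_finite⟩

/-- The delta-matroid of the region: the full Higgs lift delta-matroid of the pair
`(M(R_min), M(R_max))`. -/
def deltaMatroid (R : LatticePathRegion) : SetSystem ℤ := fullHiggsLift R.minMatroid R.maxMatroid

end LatticePathRegion

/-- A lattice path delta-matroid: a set system isomorphic to the full Higgs lift delta-matroid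
that arises from some lattice path region. -/
def SetSystem.IsLatticePathDeltaMatroid {α : Type*} (S : SetSystem α) : Prop :=
  ∃ R : LatticePathRegion, S.Isomorphic R.deltaMatroid

/-!
The feasible sets of the delta-matroid of a region are exactly the label sets of *all* lattice
paths that stay in the region, starting anywhere on the segment `s_P s_Q` and ending anywhere on
`t_P t_Q`. In one direction, clamping the height of such a path to `[d, v - c]` drops north steps
and gives a path from `s_Q` to `t_P`, and moving it into the strip between the vertical lines
through `s_P` and `t_Q` adds north steps and gives a path from `s_P` to `t_Q`. In the other
direction, if `A ⊆ F ⊆ B` with `A` and `B` coming from paths of these two kinds, then the number of elements of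
`F` in any interval of labels is at least that of `A` and at most that of `B`; this is just what is
needed for a starting height from which the path with label set `F` stays in the region
(`LatticePathRegion.deltaMatroid_feasible_iff`).

So a lattice path delta-matroid is encoded by two bounding height functions `p ≤ q` and an
enumeration of the ground set (`SetSystem.IsBandPresentation`). Duality replaces a height `h i` by
`i - h i` and so exchanges the roles of `p` and `q`. Deletion of an element that is not a coloop
keeps the paths that are level at one step, and contracts that step; the bounding functions are
tightened so that they still move by unit steps. The tightened functions may violate the one
remaining requirement on a region, `u ≥ 0`; this is repaired by cutting the upper bound off at the
height `p 0 + n`, since a path that ends above that height can be lowered as a whole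
(`SetSystem.IsBandPresentation.truncate`). Contraction is the dual of deletion.
-/

/-! ### Paths in a band -/

/-- The function `h` on `{0, …, n}` is the height function of a lattice path with `n` steps. -/
def IsHeight (n : ℕ) (h : ℕ → ℤ) : Prop := ∀ i < n, h (i + 1) = h i ∨ h (i + 1) = h i + 1

theorem IsHeight.bounds {n : ℕ} {h : ℕ → ℤ} (hh : IsHeight n h) {i j : ℕ} (hij : i ≤ j)
    (hj : j ≤ n) : h i ≤ h j ∧ h j ≤ h i + ((j : ℤ) - i) := by
  induction j, hij using Nat.le_induction with
  | base => omega
  | succ j hij ih =>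
    have := ih (by omega)
    have := hh j (by omega)
    push_cast
    omega

namespace SetSystem

variable {α β : Type*}

/-- The height function `h` rises exactly at the elements of `X`, where `f x` is the number of
steps that precede the step belonging to the element `x` of `E`. -/
def Traces (E : Set α) (f : α → ℕ) (X : Set α) (h : ℕ → ℤ) : Prop :=
  ∀ x ∈ E, (x ∈ X → h (f x + 1) = h (f x) + 1) ∧ (x ∉ X → h (f x + 1) = h (f x))

/-- The height function `h` stays in the band between `p` and `q`. -/
def InBand (n : ℕ) (p q h : ℕ → ℤ) : Prop := ∀ i ≤ n, p i ≤ h i ∧ h i ≤ q i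

/-- The ground set of `S` is enumerated by `f`, and its feasible sets are the sets of north steps
of the lattice paths in the band between `p` and `q`, with free starting and end points. The
requirement `q n ≤ p 0 + n`, which also holds in a lattice path region, is not included. -/
structure IsBandPresentation (S : SetSystem α) (n : ℕ) (f : α → ℕ) (p q : ℕ → ℤ) : Prop where
  bij : Set.BijOn f S.ground (Set.Iio n)
  lower : IsHeight n p
  upper : IsHeight n q
  le : ∀ i ≤ n, p i ≤ q i
  start_le_end : q 0 ≤ p n
  feasible_iff : ∀ X ⊆ S.ground, X ∈ S.feasible ↔ ∃ h, InBand n p q h ∧ Traces S.ground f X h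

theorem Traces.isHeight {E : Set α} {n : ℕ} {f : α → ℕ} {X : Set α} {h : ℕ → ℤ}
    (hf : Set.BijOn f E (Set.Iio n)) (hX : Traces E f X h) : IsHeight n h := by
  intro i hi
  obtain ⟨x, hx, rfl⟩ := hf.surjOn hi
  by_cases hxX : x ∈ X
  · exact Or.inr ((hX x hx).1 hxX)
  · exact Or.inl ((hX x hx).2 hxX)

theorem Traces.shift {E : Set α} {f : α → ℕ} {X : Set α} {h : ℕ → ℤ} (hX : Traces E f X h)
    (t : ℤ) : Traces E f X (fun i => h i + t) := by
  intro x hx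
  obtain ⟨h1, h2⟩ := hX x hx
  exact ⟨fun h => by have := h1 h; dsimp only; omega, fun h => by have := h2 h; dsimp only; omega⟩

namespace IsBandPresentation

variable {S : SetSystem α} {T : SetSystem β} {n : ℕ} {f : α → ℕ} {g : β → ℕ} {p q : ℕ → ℤ}

theorem translate (hS : S.IsBandPresentation n f p q) (t : ℤ) :
    S.IsBandPresentation n f (fun i => p i + t) (fun i => q i + t) where
  bij := hS.bij
  lower i hi := by have := hS.lower i hi; dsimp only; omega
  upper i hi := by have := hS.upper i hi; dsimp only; omega
  le i hi := by have := hS.le i hi; omega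
  start_le_end := by have := hS.start_le_end; omega
  feasible_iff X hX := by
    rw [hS.feasible_iff X hX]
    constructor
    · rintro ⟨h, hb, ht⟩
      exact ⟨_, fun i hi => by have := hb i hi; dsimp only; omega, ht.shift t⟩
    · rintro ⟨h, hb, ht⟩
      exact ⟨_, fun i hi => by have := hb i hi; dsimp only at this ⊢; omega, ht.shift (-t)⟩

/-- Cutting off the upper bound at the greatest height that can be reached from the lowest
starting point does not change the feasible sets. -/
theorem truncate (hS : S.IsBandPresentation n f p q) :
    S.IsBandPresentation n f p (fun i => min (q i) (p 0 + n)) where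
  bij := hS.bij
  lower := hS.lower
  upper i hi := by have := hS.upper i hi; dsimp only; omega
  le i hi := by
    have := hS.le i hi
    have := hS.lower.bounds (Nat.zero_le i) hi
    push_cast at *; omega
  start_le_end := by have := hS.start_le_end; omega
  feasible_iff X hX := by
    rw [hS.feasible_iff X hX]
    constructor
    · rintro ⟨h, hb, ht⟩
      -- A path that ends at height `p 0 + n + t` with `t > 0` is everywhere at least `t` above
      -- the steepest path from the height `p 0`, and hence above `p`.
      refine ⟨_, fun i hi => ?_, ht.shift (-(max 0 (h n - p 0 - n)))⟩
      have h1 := hb i hi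
      have h2 := (ht.isHeight hS.bij).bounds hi le_rfl
      have h3 := hS.lower.bounds (Nat.zero_le i) hi
      push_cast at h3
      dsimp only
      omega
    · rintro ⟨h, hb, ht⟩
      exact ⟨h, fun i hi => by have := hb i hi; dsimp only at this; omega, ht⟩

theorem exists_feasible (hS : S.IsBandPresentation n f p q) : ∃ F, F ∈ S.feasible := by
  refine ⟨{x ∈ S.ground | p (f x + 1) = p (f x) + 1}, ?_⟩
  rw [hS.feasible_iff _ (fun x hx => hx.1)]
  refine ⟨p, fun i hi => ⟨le_rfl, hS.le i hi⟩, fun x hx => ⟨fun h => h.2, fun h => ?_⟩⟩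
  exact (hS.lower (f x) (hS.bij.mapsTo hx)).resolve_right fun h' => h ⟨hx, h'⟩

theorem of_isomorphic (hT : T.IsBandPresentation n g p q) (h : S.Isomorphic T) :
    ∃ f, S.IsBandPresentation n f p q := by
  classical
  obtain ⟨φ, hφ⟩ := h
  let f : α → ℕ := fun x => if hx : x ∈ S.ground then g (φ ⟨x, hx⟩) else 0
  have hf : ∀ x : S.ground, f x = g (φ x) := fun x => dif_pos x.2
  refine ⟨f, ⟨⟨?_, ?_, ?_⟩, hT.lower, hT.upper, hT.le, hT.start_le_end, ?_⟩⟩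
  · intro x hx
    rw [hf ⟨x, hx⟩]
    exact hT.bij.mapsTo (φ _).2
  · intro x hx y hy hxy
    rw [hf ⟨x, hx⟩, hf ⟨y, hy⟩] at hxy
    have := φ.injective (Subtype.ext (hT.bij.injOn (φ _).2 (φ _).2 hxy))
    exact congrArg Subtype.val this
  · intro i hi
    obtain ⟨y, hy, rfl⟩ := hT.bij.surjOn hi
    refine ⟨φ.symm ⟨y, hy⟩, (φ.symm ⟨y, hy⟩).2, ?_⟩
    rw [hf]; simp
  · intro X hX
    obtain ⟨A, rfl⟩ : ∃ A : Set S.ground, X = Subtype.val '' A :=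
      ⟨Subtype.val ⁻¹' X, by simpa using hX⟩
    rw [hφ, hT.feasible_iff _ (by rintro _ ⟨y, -, rfl⟩; exact y.2)]
    refine exists_congr fun h => and_congr_right fun _ => ?_
    constructor
    · intro H x hx
      have := H (φ ⟨x, hx⟩) (φ _).2
      simpa [hf ⟨x, hx⟩, hx] using this
    · intro H y hy
      obtain ⟨x, hx⟩ := φ.surjective ⟨y, hy⟩
      have := H x x.2
      obtain rfl : y = φ x := by rw [hx]
      simpa [hf x] using this

/-- A band presentation determines the set system up to isomorphism. -/
theorem isomorphic (hS : S.IsBandPresentation n f p q) (hT : T.IsBandPresentation n g p q) :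
    S.Isomorphic T := by
  let φ : S.ground ≃ T.ground := (hS.bij.equiv f).trans (hT.bij.equiv g).symm
  have hφ : ∀ x, g (φ x) = f x := fun x =>
    congrArg Subtype.val ((hT.bij.equiv g).apply_symm_apply (hS.bij.equiv f x))
  refine ⟨φ, fun A => ?_⟩
  rw [hS.feasible_iff _ (by rintro _ ⟨y, -, rfl⟩; exact y.2),
    hT.feasible_iff _ (by rintro _ ⟨y, -, rfl⟩; exact y.2)]
  refine exists_congr fun h => and_congr_right fun _ => ?_
  constructor
  · intro H y hy
    obtain ⟨x, hx⟩ := φ.surjective ⟨y, hy⟩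
    have := H x x.2
    obtain rfl : y = φ x := by rw [hx]
    rw [hφ]
    simpa using this
  · intro H x hx
    have := H (φ ⟨x, hx⟩) (φ _).2
    rw [hφ] at this
    simpa [hx] using this

/-! ### Duality -/

theorem dual (hS : S.IsBandPresentation n f p q) (hn : q n ≤ p 0 + n) :
    S.dual.IsBandPresentation n f (fun i => i - q i) (fun i => i - p i) where
  bij := hS.bij
  lower i hi := by have := hS.upper i hi; dsimp only; push_cast; omega
  upper i hi := by have := hS.lower i hi; dsimp only; push_cast; omega
  le i hi := by have := hS.le i hi; omega
  start_le_end := by push_cast; omega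
  feasible_iff X hX := by
    change X ⊆ S.ground at hX
    have hd : X ∈ S.dual.feasible ↔ S.ground \ X ∈ S.feasible := by
      constructor
      · rintro ⟨F, hF, rfl⟩
        have hFE := S.subset_ground F hF
        convert hF using 1
        ext x
        have := @hFE x
        simp only [Set.mem_sdiff, Set.mem_symmDiff]
        tauto
      · intro hF
        refine ⟨_, hF, ?_⟩
        ext x
        have := @hX x
        simp only [Set.mem_sdiff, Set.mem_symmDiff]
        tauto
    rw [hd, hS.feasible_iff _ Set.sdiff_subset]
    change _ ↔ ∃ h, _ ∧ Traces S.ground f X h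
    constructor
    all_goals
      rintro ⟨h, hb, ht⟩
      refine ⟨fun i => i - h i, fun i hi => ?_, fun x hx => ?_⟩
      · have := hb i hi
        dsimp only at this ⊢; omega
      · obtain ⟨h1, h2⟩ := ht x hx
        simp only [Set.mem_sdiff, hx, true_and, not_not] at h1 h2 ⊢
        push_cast
        exact ⟨fun h => by have := h2 h; omega, fun h => by have := h1 h; omega⟩

/-! ### Deletion -/

/-- The paths in the band that are level at the step of `e` become, when that step is contracted,
the paths in a band with tightened bounds. -/
theorem avoid (hS : S.IsBandPresentation n f p q) {e : α} (he : e ∈ S.ground)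
    (hc : ¬ S.IsColoop e) : ∃ m f' p' q', (S.avoid e).IsBandPresentation m f' p' q' := by
  obtain ⟨F, hF, heF⟩ : ∃ F ∈ S.feasible, e ∉ F := by
    by_contra! hcon
    exact hc ⟨he, hcon⟩
  have hk : f e < n := hS.bij.mapsTo he
  obtain ⟨k, hfe⟩ : ∃ k, f e = k := ⟨_, rfl⟩
  obtain ⟨m, rfl⟩ : ∃ m, n = m + 1 := ⟨n - 1, by omega⟩
  rw [hfe] at hk
  have hne : ∀ x ∈ S.ground, x ≠ e → f x ≠ k := fun x hx hxe hfx =>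
    hxe (hS.bij.injOn hx he (hfx.trans hfe.symm))
  let f' : α → ℕ := fun x => if f x < k then f x else f x - 1
  -- A path that is level at step `k` has height at least `p (k + 1)` before that step and at most
  -- `q k` after it; the unit steps propagate these bounds to the left and to the right.
  let p' : ℕ → ℤ := fun i => if i ≤ k then max (p i) (p (k + 1) - (k - i)) else p (i + 1)
  let q' : ℕ → ℤ := fun i => if i ≤ k then q i else min (q (i + 1)) (q k + (i - k))
  have squeeze : ∀ h, InBand (m + 1) p q h → IsHeight (m + 1) h → h (k + 1) = h k →
      InBand m p' q' (fun i => if i ≤ k then h i else h (i + 1)) := by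
    intro h hb hh hlevel i hi
    have hbk := hb k (by omega)
    have hbk' := hb (k + 1) (by omega)
    dsimp only [p', q']
    split_ifs with hik
    · have h1 := hb i (by omega)
      have h2 := hh.bounds hik (by omega)
      omega
    · have h1 := hb (i + 1) (by omega)
      have h2 := hh.bounds (i := k + 1) (j := i + 1) (by omega) (by omega)
      push_cast at h2
      omega
  have htrace : ∀ X h, Traces S.ground f X h → e ∉ X → h (k + 1) = h k := by
    intro X h ht heX
    have := (ht e he).2 heX
    rwa [hfe] at this
  refine ⟨m, f', p', q', ⟨?_, ?_, ?_⟩, ?_, ?_, ?_, ?_, ?_⟩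
  · rintro x ⟨hx, hxe⟩
    have h1 := hne x hx hxe
    have h2 : f x < m + 1 := hS.bij.mapsTo hx
    change f' x < m
    dsimp only [f']; split_ifs <;> omega
  · rintro x ⟨hx, hxe⟩ y ⟨hy, hye⟩ hxy
    have h1 := hne x hx hxe
    have h2 := hne y hy hye
    refine hS.bij.injOn hx hy ?_
    dsimp only [f'] at hxy
    split_ifs at hxy <;> omega
  · intro i hi
    have hi : i < m := hi
    by_cases hik : i < k
    · obtain ⟨x, hx, hfx⟩ := hS.bij.surjOn (show i ∈ Set.Iio (m + 1) from by
        simp only [Set.mem_Iio]; omega)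
      refine ⟨x, ⟨hx, ?_⟩, ?_⟩
      · rintro rfl; omega
      · dsimp only [f']; rw [if_pos (by omega), hfx]
    · obtain ⟨x, hx, hfx⟩ := hS.bij.surjOn (show i + 1 ∈ Set.Iio (m + 1) from by
        simp only [Set.mem_Iio]; omega)
      refine ⟨x, ⟨hx, ?_⟩, ?_⟩
      · rintro rfl; omega
      · dsimp only [f']; rw [if_neg (by omega), hfx]; rfl
  · intro i hi
    have h1 := hS.lower i (by omega)
    have h2 := hS.lower (i + 1) (by omega)
    dsimp only [p']
    push_cast
    rcases lt_trichotomy i k with hik | rfl | hik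
    · rw [if_pos (by omega), if_pos (by omega)]; omega
    · rw [if_neg (by omega), if_pos (by omega)]; omega
    · rw [if_neg (by omega), if_neg (by omega)]; omega
  · intro i hi
    have h1 := hS.upper i (by omega)
    have h2 := hS.upper (i + 1) (by omega)
    dsimp only [q']
    push_cast
    rcases lt_trichotomy i k with hik | rfl | hik
    · rw [if_pos (by omega), if_pos (by omega)]; omega
    · rw [if_neg (by omega), if_pos (by omega)]; omega
    · rw [if_neg (by omega), if_neg (by omega)]; omega
  · -- a feasible set that avoids `e` witnesses that the new bounds do not cross
    obtain ⟨h, hb, ht⟩ := (hS.feasible_iff F (S.subset_ground F hF)).1 hF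
    intro i hi
    have := squeeze h hb (ht.isHeight hS.bij) (htrace F h ht heF) i hi
    exact this.1.trans this.2
  · have h0 := hS.start_le_end
    dsimp only [p', q']
    rw [if_pos (by omega)]
    split_ifs with hmk
    · obtain rfl : m = k := by omega
      omega
    · exact h0
  · intro X hX
    have hXS : X ⊆ S.ground := fun x hx => (hX hx).1
    have heX : e ∉ X := fun h => (hX h).2 rfl
    have : X ∈ (S.avoid e).feasible ↔ X ∈ S.feasible := ⟨fun h => h.1, fun h => ⟨h, hX⟩⟩
    rw [this, hS.feasible_iff X hXS]
    constructor
    · rintro ⟨h, hb, ht⟩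
      refine ⟨_, squeeze h hb (ht.isHeight hS.bij) (htrace X h ht heX), ?_⟩
      rintro x ⟨hx, hxe⟩
      have h1 := hne x hx hxe
      have h2 := htrace X h ht heX
      have h3 := ht x hx
      dsimp only [f']
      rcases lt_or_gt_of_ne h1 with hlt | hgt
      · rw [if_pos hlt, if_pos (by omega), if_pos (by omega)]
        exact h3
      · rw [if_neg (show ¬ f x < k by omega), show f x - 1 + 1 = f x by omega,
          if_neg (show ¬ f x ≤ k by omega)]
        split_ifs with h4
        · obtain h5 : f x = k + 1 := by omega
          rw [h5] at h3 ⊢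
          rw [show k + 1 - 1 = k by omega, ← h2]
          exact h3
        · exact h3
    · rintro ⟨h, hb, ht⟩
      refine ⟨fun i => if i ≤ k then h i else h (i - 1), fun i hi => ?_, fun x hx => ?_⟩
      · dsimp only [InBand, p', q'] at hb
        dsimp only
        split_ifs with hik
        · have h1 := hb i (by omega)
          simp only [hik, if_true] at h1
          omega
        · have h1 := hb (i - 1) (by omega)
          rcases eq_or_ne i (k + 1) with rfl | hne'
          · have h2 := hS.upper k (by omega)
            simp only [Nat.add_sub_cancel, le_refl, if_true] at h1 ⊢
            omega
          · rw [if_neg (by omega), if_neg (by omega), show i - 1 + 1 = i by omega] at h1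
            omega
      · dsimp only
        rcases eq_or_ne x e with rfl | hxe
        · rw [hfe]
          simp [heX]
        · have h1 := hne x hx hxe
          have h3 := ht x ⟨hx, hxe⟩
          dsimp only [f'] at h3
          rcases lt_or_gt_of_ne h1 with hlt | hgt
          · rw [if_pos hlt] at h3
            rw [if_pos (by omega), if_pos (by omega)]
            exact h3
          · rw [if_neg (by omega), show f x - 1 + 1 = f x by omega] at h3
            rw [if_neg (by omega), if_neg (by omega), Nat.add_sub_cancel]
            exact h3

end IsBandPresentation

/-- Contraction is the dual of deletion. -/
theorem link_eq_dual_avoid_dual (S : SetSystem α) {e : α} (he : e ∈ S.ground) :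
    S.link e = (S.dual.avoid e).dual := by
  have hfeas : (S.link e).feasible = ((S.dual.avoid e).dual).feasible := by
    ext X
    constructor
    · rintro ⟨F, hF, heF, rfl⟩
      refine ⟨S.ground \ F, ⟨⟨F, hF, ?_⟩, ?_⟩, ?_⟩
      · ext x
        have := S.subset_ground F hF (a := x)
        simp only [Set.mem_sdiff, Set.mem_symmDiff]
        tauto
      · rintro x ⟨hx, hxF⟩
        exact ⟨hx, fun h => hxF (h ▸ heF)⟩
      · ext x
        have := S.subset_ground F hF (a := x)
        simp only [avoid, dual, twist, Set.mem_sdiff, Set.mem_symmDiff, Set.mem_singleton_iff]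
        by_cases hxe : x = e
        · subst hxe; tauto
        · tauto
    · rintro ⟨G, ⟨⟨F, hF, rfl⟩, hG⟩, rfl⟩
      have heF : e ∈ F := by
        by_contra hcon
        exact (hG (Or.inr ⟨he, hcon⟩)).2 rfl
      refine ⟨F, hF, heF, ?_⟩
      ext x
      have := S.subset_ground F hF (a := x)
      simp only [avoid, dual, twist, Set.mem_sdiff, Set.mem_symmDiff, Set.mem_singleton_iff]
      by_cases hxe : x = e
      · subst hxe; tauto
      · tauto
  have hground : (S.link e).ground = ((S.dual.avoid e).dual).ground := rfl
  revert hfeas hground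
  generalize S.link e = A
  generalize (S.dual.avoid e).dual = B
  cases A; cases B
  rintro rfl rfl
  rfl

theorem isColoop_dual_iff (S : SetSystem α) (e : α) : S.dual.IsColoop e ↔ S.IsLoop e := by
  refine and_congr_right fun he => ?_
  change e ∈ S.ground at he
  constructor
  · intro h F hF heF
    have := h _ ⟨F, hF, rfl⟩
    simp only [Set.mem_symmDiff] at this
    tauto
  · rintro h _ ⟨F, hF, rfl⟩
    exact Or.inr ⟨he, h F hF⟩

end SetSystem

/-! ### The delta-matroid of a region -/

/-- Feasibility in a full Higgs lift: the condition on the size is automatic. -/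
theorem mem_fullHiggsLift_iff {α : Type*} (Q L : Matroid α) [L.Finite] (F : Set α) :
    F ∈ (fullHiggsLift Q L).feasible ↔ ∃ A B, Q.IsBase A ∧ L.IsBase B ∧ A ⊆ F ∧ F ⊆ B := by
  constructor
  · rintro ⟨i, -, -, h⟩
    exact h
  · rintro ⟨A, B, hA, hB, hAF, hFB⟩
    have hfin : F.Finite := (L.ground_finite.subset hB.subset_ground).subset hFB
    obtain ⟨c, hc⟩ := exists_add_of_le (Set.encard_le_encard hAF)
    have hcfin : c ≠ ⊤ := by
      rintro rfl
      exact hfin.encard_lt_top.ne (by simpa using hc)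
    lift c to ℕ using hcfin
    refine ⟨c, ?_, ?_, A, B, hA, hB, hAF, hFB⟩
    · rw [← hA.encard_eq_eRank, ← hB.encard_eq_eRank, ← hc]
      exact Set.encard_le_encard hFB
    · rw [← hA.encard_eq_eRank, hc]

namespace LatticePathRegion

/-- If the labels of one path are among those of another, then the rise of the first path along
any interval is at most that of the second. -/
theorem rise_le_of_subset {n : ℕ} {a b : ℕ → ℤ} (ha : IsHeight n a) (hb : IsHeight n b)
    (hab : ∀ i < n, a (i + 1) = a i + 1 → b (i + 1) = b i + 1) {i j : ℕ} (hij : i ≤ j)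
    (hj : j ≤ n) : a j - a i ≤ b j - b i := by
  induction j, hij using Nat.le_induction with
  | base => omega
  | succ j hij ih =>
    have h1 := ih (by omega)
    have h2 := ha j (by omega)
    have h3 := hb j (by omega)
    have h4 := hab j (by omega)
    omega

/-- The feasible sets of the delta-matroid of a region are the label sets of all lattice paths in
the region, with arbitrary starting and end points on the two segments that bound it. -/
theorem deltaMatroid_feasible_iff (R : LatticePathRegion) {F : Set ℤ} (hF : F ⊆ R.labels) :
    F ∈ R.deltaMatroid.feasible ↔ ∃ h : ℕ → ℤ,
      SetSystem.InBand (R.u + R.v) (fun i => (R.P i).2) (fun i => (R.Q i).2) h ∧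
      ∀ i < R.u + R.v, ((i : ℤ) + 1 ∈ F → h (i + 1) = h i + 1) ∧
        ((i : ℤ) + 1 ∉ F → h (i + 1) = h i) := by
  classical
  rw [deltaMatroid, mem_fullHiggsLift_iff]
  have hmin : ∀ A, R.minMatroid.IsBase A ↔ R.IsPathBase R.sQ R.tP A := fun A => Iff.rfl
  have hmax : ∀ A, R.maxMatroid.IsBase A ↔ R.IsPathBase R.sP R.tQ A := fun A => Iff.rfl
  simp only [hmin, hmax, R.isPathBase_iff (s := R.sQ) (t := R.tP) (by simp [sQ]) (by simp [tP]),
    R.isPathBase_iff (s := R.sP) (t := R.tQ) (by simp [sP]) (by simp [tQ])]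
  constructor
  · rintro ⟨A, B, ⟨a, ha, a0, an, ab, rfl⟩, ⟨b, hb, b0, bn, bb, rfl⟩, hAF, hFB⟩
    let H : ℕ → ℤ := fun i => ∑ j ∈ Finset.range i, if (j : ℤ) + 1 ∈ F then 1 else 0
    have hH : ∀ i : ℕ, ((i : ℤ) + 1 ∈ F → H (i + 1) = H i + 1) ∧
        ((i : ℤ) + 1 ∉ F → H (i + 1) = H i) := by
      intro i
      dsimp only [H]
      rw [Finset.sum_range_succ]
      exact ⟨fun h => by rw [if_pos h], fun h => by rw [if_neg h, add_zero]⟩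
    have hHh : IsHeight (R.u + R.v) H := fun i _ => by
      by_cases h : (i : ℤ) + 1 ∈ F
      · exact Or.inr ((hH i).1 h)
      · exact Or.inl ((hH i).2 h)
    have haH : ∀ i < R.u + R.v, a (i + 1) = a i + 1 → H (i + 1) = H i + 1 :=
      fun i hi h => (hH i).1 (hAF ⟨i, hi, h, rfl⟩)
    have hHb : ∀ i < R.u + R.v, H (i + 1) = H i + 1 → b (i + 1) = b i + 1 := by
      intro i hi h
      have hiF : (i : ℤ) + 1 ∈ F := by
        by_contra hcon
        have := (hH i).2 hcon
        omega
      obtain ⟨j, -, h1, h2⟩ := hFB hiF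
      obtain rfl : i = j := by omega
      exact h1
    -- the least starting height for which the path stays above `P`
    obtain ⟨i₀, hi₀, hmax₀⟩ := Finset.exists_max_image (Finset.range (R.u + R.v + 1))
      (fun i => (R.P i).2 - H i) ⟨0, by simp⟩
    rw [Finset.mem_range] at hi₀
    refine ⟨fun i => H i + ((R.P i₀).2 - H i₀), fun j hj => ⟨?_, ?_⟩, fun i _ => ?_⟩
    · have := hmax₀ j (by rw [Finset.mem_range]; omega)
      dsimp only at this ⊢; omega
    · dsimp only
      rcases le_total j i₀ with hji | hij
      · have h1 := rise_le_of_subset ha hHh haH hji (by omega)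
        have h2 := ab j hj
        have h3 := ab i₀ (by omega)
        omega
      · have h1 := rise_le_of_subset hHh hb hHb hij hj
        have h2 := bb j hj
        have h3 := bb i₀ (by omega)
        omega
    · obtain ⟨h1, h2⟩ := hH i
      exact ⟨fun h => by have := h1 h; dsimp only; omega,
        fun h => by have := h2 h; dsimp only; omega⟩
  · rintro ⟨h, hb, hF'⟩
    have hstep : IsHeight (R.u + R.v) h := fun i hi => by
      by_cases hiF : (i : ℤ) + 1 ∈ F
      · exact Or.inr ((hF' i hi).1 hiF)
      · exact Or.inl ((hF' i hi).2 hiF)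
    have hP : IsHeight (R.u + R.v) (fun i => (R.P i).2) := height_step R.path_P
    have hQ : IsHeight (R.u + R.v) (fun i => (R.Q i).2) := height_step R.path_Q
    have hPs : (R.P 0).2 = 0 := by rw [R.P_start]
    have hQs : (R.Q 0).2 = R.d := by rw [R.Q_start]
    have hPe : (R.P (R.u + R.v)).2 = (R.v : ℤ) - R.c := by rw [R.P_end]
    have hQe : (R.Q (R.u + R.v)).2 = R.v := by rw [R.Q_end]
    have hd := R.d_le
    have hb0 := hb 0 (by omega)
    have hbn := hb _ le_rfl
    have hbP : ∀ i ≤ R.u + R.v, (R.P i).2 ≤ i ∧ (R.P i).2 ≤ (R.v : ℤ) - R.c := fun i hi => by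
      have h1 := hP.bounds (Nat.zero_le i) hi
      have h2 := hP.bounds hi le_rfl
      push_cast at h1 h2
      omega
    have hbQ : ∀ i ≤ R.u + R.v, (i : ℤ) - R.u ≤ (R.Q i).2 ∧ (R.d : ℤ) ≤ (R.Q i).2 :=
      fun i hi => by
      have h1 := hQ.bounds (Nat.zero_le i) hi
      have h2 := hQ.bounds hi le_rfl
      push_cast at h1 h2
      omega
    dsimp only at hb0 hbn
    -- Clamping drops north steps; the second path starts and ends with added north steps.
    refine ⟨_, _, ⟨fun i => min (max (h i) R.d) (R.v - R.c), ?_, ?_, ?_, ?_, rfl⟩,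
      ⟨fun i => max (min (h i) i) (i - R.u), ?_, ?_, ?_, ?_, rfl⟩, ?_, ?_⟩
    · intro i hi
      have := hstep i hi
      dsimp only; omega
    · simp only [sQ]; omega
    · simp only [tP]; omega
    · intro i hi
      have h1 := hb i hi
      have h2 := hbP i hi
      have h3 := hbQ i hi
      dsimp only at h1 ⊢; omega
    · intro i hi
      have := hstep i hi
      dsimp only; push_cast; omega
    · simp only [sP]; push_cast; omega
    · simp only [tQ]; push_cast; omega
    · intro i hi
      have h1 := hb i hi
      have h2 := hbP i hi
      have h3 := hbQ i hi
      dsimp only at h1 ⊢; omega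
    · rintro k ⟨i, hi, h1, rfl⟩
      by_contra hcon
      have := (hF' i hi).2 hcon
      dsimp only at h1
      omega
    · intro k hk
      obtain ⟨hk1, hk2⟩ := hF hk
      obtain ⟨i, rfl⟩ : ∃ i : ℕ, k = (i : ℤ) + 1 := ⟨(k - 1).toNat, by omega⟩
      have hi : i < R.u + R.v := by omega
      refine ⟨i, hi, ?_, rfl⟩
      have := (hF' i hi).1 hk
      dsimp only; push_cast; omega

theorem isBandPresentation (R : LatticePathRegion) :
    R.deltaMatroid.IsBandPresentation (R.u + R.v) (fun k => (k - 1).toNat)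
      (fun i => (R.P i).2) (fun i => (R.Q i).2) where
  bij := by
    refine ⟨?_, ?_, ?_⟩
    · rintro k ⟨h1, h2⟩
      simp only [Set.mem_Iio]; omega
    · rintro k ⟨h1, h2⟩ l ⟨h3, h4⟩ h
      dsimp only at h; omega
    · intro i hi
      rw [Set.mem_Iio] at hi
      exact ⟨i + 1, ⟨by omega, by omega⟩, by simp⟩
  lower := height_step R.path_P
  upper := height_step R.path_Q
  le := R.P_le_Q
  start_le_end := by
    have := R.d_le
    simp only [R.Q_start, R.P_end]; omega
  feasible_iff F hF := by
    rw [R.deltaMatroid_feasible_iff hF]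
    refine exists_congr fun h => and_congr_right fun _ => ?_
    constructor
    · rintro H k ⟨hk1, hk2⟩
      obtain ⟨i, rfl⟩ : ∃ i : ℕ, k = (i : ℤ) + 1 := ⟨(k - 1).toNat, by omega⟩
      simpa using H i (by omega)
    · intro H i hi
      simpa using H ((i : ℤ) + 1) ⟨by omega, by omega⟩

/-- The region between the paths from `s_P` and `s_Q` with the heights `p` and `q`; the abscissa of
the `i`-th point is recovered from its lying on the line `x + y = i`. -/
def ofHeights (n : ℕ) (p q : ℕ → ℤ) (hp : IsHeight n p) (hq : IsHeight n q)
    (hpq : ∀ i ≤ n, p i ≤ q i) (hqp : q 0 ≤ p n) (hn : q n ≤ n) (hp0 : p 0 = 0) :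
    LatticePathRegion where
  u := (n - q n).toNat
  v := (q n).toNat
  c := (q n - p n).toNat
  d := (q 0).toNat
  d_le := by
    have := hpq 0 (by omega)
    have := hpq n le_rfl
    omega
  P i := (i - p i, p i)
  Q i := (i - q i, q i)
  path_P i hi := by
    have := hpq 0 (by omega)
    have := hpq n le_rfl
    rcases hp i (by omega) with h | h
    · left; ext <;> simp [h]; ring
    · right; ext <;> simp [h]
  path_Q i hi := by
    have := hpq 0 (by omega)
    have := hpq n le_rfl
    rcases hq i (by omega) with h | h
    · left; ext <;> simp [h]; ring
    · right; ext <;> simp [h]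
  P_start := by simp [hp0]
  P_end := by
    have := hpq 0 (by omega)
    have := hpq n le_rfl
    have h : (n - q n).toNat + (q n).toNat = n := by omega
    rw [h]
    ext <;> dsimp only <;> omega
  Q_start := by
    have := hpq 0 (by omega)
    ext <;> simp <;> omega
  Q_end := by
    have := hpq 0 (by omega)
    have := hpq n le_rfl
    have h : (n - q n).toNat + (q n).toNat = n := by omega
    rw [h]
    ext <;> dsimp only <;> omega
  P_le_Q i hi := hpq i (by
    have := hpq 0 (by omega)
    have := hpq n le_rfl
    omega)

end LatticePathRegion

/-! ### Closure under duals and minors -/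

namespace SetSystem

variable {α : Type*} {S : SetSystem α}

/-- Every band presentation comes from a region: after truncation the upper bound satisfies the
condition `u ≥ 0`, and a translation makes the lower bound start at `0`. -/
theorem IsBandPresentation.isLatticePathDeltaMatroid {n : ℕ} {f : α → ℕ} {p q : ℕ → ℤ}
    (hS : S.IsBandPresentation n f p q) : S.IsLatticePathDeltaMatroid := by
  have h := hS.truncate.translate (-p 0)
  let R := LatticePathRegion.ofHeights n _ _ h.lower h.upper h.le h.start_le_end
    (by omega) (by omega)
  have hn : R.u + R.v = n := by
    have h0 := h.le 0 (by omega)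
    have h1 := h.start_le_end
    have h2 := h.le n le_rfl
    dsimp only [R, LatticePathRegion.ofHeights]
    omega
  have hR := R.isBandPresentation
  rw [hn] at hR
  exact ⟨R, h.isomorphic hR⟩

theorem IsLatticePathDeltaMatroid.exists_isBandPresentation (hS : S.IsLatticePathDeltaMatroid) :
    ∃ n f p q, S.IsBandPresentation n f p q ∧ q n ≤ p 0 + n := by
  obtain ⟨R, hR⟩ := hS
  obtain ⟨f, hf⟩ := R.isBandPresentation.of_isomorphic hR
  refine ⟨_, f, _, _, hf, ?_⟩
  simp only [R.P_start, R.Q_end]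
  push_cast; omega

theorem IsLatticePathDeltaMatroid.dual (hS : S.IsLatticePathDeltaMatroid) :
    S.dual.IsLatticePathDeltaMatroid := by
  obtain ⟨n, f, p, q, h, hn⟩ := hS.exists_isBandPresentation
  exact (h.dual hn).isLatticePathDeltaMatroid

theorem IsLatticePathDeltaMatroid.avoid (hS : S.IsLatticePathDeltaMatroid) {e : α}
    (he : e ∈ S.ground) (hc : ¬ S.IsColoop e) : (S.avoid e).IsLatticePathDeltaMatroid := by
  obtain ⟨n, f, p, q, h, -⟩ := hS.exists_isBandPresentation
  obtain ⟨_, _, _, _, h'⟩ := h.avoid he hc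
  exact h'.isLatticePathDeltaMatroid

theorem IsLatticePathDeltaMatroid.link (hS : S.IsLatticePathDeltaMatroid) {e : α}
    (he : e ∈ S.ground) (hl : ¬ S.IsLoop e) : (S.link e).IsLatticePathDeltaMatroid := by
  rw [S.link_eq_dual_avoid_dual he]
  exact (hS.dual.avoid he (by rwa [isColoop_dual_iff])).dual

theorem IsLatticePathDeltaMatroid.not_isLoop_and_isColoop (hS : S.IsLatticePathDeltaMatroid)
    (e : α) : ¬ (S.IsLoop e ∧ S.IsColoop e) := by
  rintro ⟨hl, hc⟩
  obtain ⟨n, f, p, q, h, -⟩ := hS.exists_isBandPresentation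
  obtain ⟨F, hF⟩ := h.exists_feasible
  exact hl.2 F hF (hc.2 F hF)

theorem IsLatticePathDeltaMatroid.delete (hS : S.IsLatticePathDeltaMatroid) {e : α}
    (he : e ∈ S.ground) : (S.delete e).IsLatticePathDeltaMatroid := by
  unfold SetSystem.delete
  split_ifs with hc
  · exact hS.link he fun hl => hS.not_isLoop_and_isColoop e ⟨hl, hc⟩
  · exact hS.avoid he hc

theorem IsLatticePathDeltaMatroid.contract (hS : S.IsLatticePathDeltaMatroid) {e : α}
    (he : e ∈ S.ground) : (S.contract e).IsLatticePathDeltaMatroid := by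
  unfold SetSystem.contract
  split_ifs with hl
  · exact hS.avoid he fun hc => hS.not_isLoop_and_isColoop e ⟨hl, hc⟩
  · exact hS.link he hl

end SetSystem

theorem mainTheorem7 {α : Type*} (S : SetSystem α) (hS : S.IsLatticePathDeltaMatroid) :
    S.dual.IsLatticePathDeltaMatroid ∧
      ∀ T : SetSystem α, S.IsMinor T → T.IsLatticePathDeltaMatroid := by
  refine ⟨hS.dual, fun T hT => ?_⟩
  induction hT with
  | refl => exact hS
  | delete _ he ih => exact ih.delete he
  | contract _ he ih => exact ih.contract he
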